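/- Let $X$ be a connected combinatorial 2-complex, i.e. a graph $X^1$ with 2-cells $r$ attached along closed edge paths $\partial_{\mathsf p} r$ of positive length. Let $\widetilde X$ be its universal cover, and write $\partial r$ for the set of cells traversed by $\partial_{\mathsf p} r$. For a preorder $\preceq$ write $a\prec b$ for $(a\preceq b)\wedge\neg(b\preceq a)$. Say that $X$ is \emph{bislim} if every attaching map is an immersion (no two cyclically consecutive oriented edges of $\partial_{\mathsf p} r$ are inverse to each other) and the following hold. \begin{enumerate} \item There is a $\pi_1X$-invariant preorder $\preceq$ on the 1-cells of $\widetilde X$. \item Each 2-cell $r$ of $\widetilde X$ has distinguished 1-cells $r^+$ and $r^-$ in $\partial r$, and $r^+$ is traversed exactly once by $\partial_{\mathsf p} r$. \item $g(r^\pm)=(gr)^\pm$ for each $g\in\pi_1X$ and each 2-cell $r$ of $\widetilde X$. \item If $r_1\ne r_2$ are 2-cells of $\widetilde X$ and $r_1^+\subset\partial r_2$, then $r_1^+\prec r_2^+$. \item If $r_1\ne r_2$ are 2-cells of $\widetilde X$ and $r_2^-\subset\partial r_1$, then $r_1^+\prec r_2^+$. \end{enumerate} \textbf{Lemma.} If $X$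 is bislim, then the 2-cells of $X$ embed in $\widetilde X$: for every lift $r$ to $\widetilde X$ of a 2-cell of $X$, the boundary path $\partial_{\mathsf p} r$ is a simple cycle in $\widetilde X$, i.e. it visits pairwise distinct 0-cells and traverses pairwise distinct 1-cells. -/

import Mathlib

universe u v w

set_option linter.checkUnivs false

/-- A combinatorial 2-complex. `V`, `E`, `F` are the sets of 0-cells, 1-cells and 2-cells. Every
1-cell carries an (arbitrary) reference orientation from `src` to `tgt`; an oriented 1-cell is a
pair `(e, b) : E × Bool`, where `b = true` stands for the reference orientation. -/
structure PreTwoComplex where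
  V : Type u
  E : Type v
  F : Type w
  src : E → V
  tgt : E → V
  /-- the 0-cell at which the boundary path of a 2-cell starts -/
  base : F → V
  /-- the boundary path of a 2-cell -/
  bdry : F → List (E × Bool)

namespace PreTwoComplex

variable (X : PreTwoComplex.{u, v, w})

/-- Initial 0-cell of an oriented 1-cell. -/
def org : X.E × Bool → X.V
  | (e, true) => X.src e
  | (e, false) => X.tgt e

/-- Terminal 0-cell of an oriented 1-cell. -/
def ter : X.E × Bool → X.V
  | (e, true) => X.tgt e
  | (e, false) => X.src e

/-- The same 1-cell with the opposite orientation. -/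
def rev (d : X.E × Bool) : X.E × Bool := (d.1, !d.2)

/-- `X.IsPath x l y`: the list `l` of oriented 1-cells is an edge path from `x` to `y`. -/
def IsPath : X.V → List (X.E × Bool) → X.V → Prop
  | x, [], y => x = y
  | x, d :: l, y => X.org d = x ∧ IsPath (X.ter d) l y

end PreTwoComplex

/-- A combinatorial 2-complex: 2-cells are attached along closed edge paths of positive length. -/
structure TwoComplex extends PreTwoComplex.{u, v, w} where
  bdry_ne_nil : ∀ f, bdry f ≠ []
  bdry_closed : ∀ f, toPreTwoComplex.IsPath (base f) (bdry f) (base f)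

namespace TwoComplex

variable (X : TwoComplex.{u, v, w})

/-- The attaching maps of the 2-cells are immersions: no two cyclically consecutive oriented
1-cells of a boundary path are inverse to each other. -/
def Immersed : Prop :=
  ∀ f : X.F, (X.bdry f ++ X.bdry f).IsChain fun a b => b ≠ X.rev a

/-- The 1-cell `e` lies in the boundary of the 2-cell `f`. -/
def OnBoundary (e : X.E) (f : X.F) : Prop := ∃ d ∈ X.bdry f, d.1 = e

/-- The boundary path of `f` traverses the 1-cell `e`, in either direction, exactly once. -/
def TraversedOnce (e : X.E) (f : X.F) : Prop :=
  ∃! i : Fin (X.bdry f).length, ((X.bdry f).get i).1 = e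

/-- The closed 2-cell `f` is embedded: its boundary path is a simple cycle, that is, it visits
pairwise distinct 0-cells and traverses pairwise distinct 1-cells. -/
def FaceEmbeds (f : X.F) : Prop :=
  ((X.bdry f).map X.org).Nodup ∧ ((X.bdry f).map Prod.fst).Nodup

/-! ### Paths up to homotopy -/

/-- Edge paths from `x` to `y`. -/
def EdgePath (x y : X.V) : Type v := {l : List (X.E × Bool) // X.IsPath x l y}

/-- Elementary homotopy of edge paths: insertion of a backtrack or of the boundary path of a
2-cell. -/
def Step {x y : X.V} (p q : X.EdgePath x y) : Prop :=
  ∃ a m b : List (X.E × Bool), p.1 = a ++ b ∧ q.1 = a ++ m ++ b ∧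
    ((∃ d, m = [d, X.rev d]) ∨ ∃ f, m = X.bdry f)

/-- Homotopy classes (relative to the endpoints) of edge paths from `x` to `y`: the quotient by
the equivalence relation generated by elementary homotopies. -/
def PathClass (x y : X.V) : Type v := Quot (X.Step (x := x) (y := y))

variable {X}

theorem isPath_append {x y z : X.V} {l m : List (X.E × Bool)}
    (hl : X.IsPath x l y) (hm : X.IsPath y m z) : X.IsPath x (l ++ m) z := by
  induction l generalizing x with
  | nil => cases hl; exact hm
  | cons d l ih => exact ⟨hl.1, ih hl.2⟩

theorem isPath_append_iff {x z : X.V} {l m : List (X.E × Bool)} :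
    X.IsPath x (l ++ m) z ↔ ∃ y, X.IsPath x l y ∧ X.IsPath y m z := by
  induction l generalizing x with
  | nil => exact ⟨fun h => ⟨x, rfl, h⟩, fun ⟨y, h, h'⟩ => by cases h; exact h'⟩
  | cons d l ih =>
    constructor
    · rintro ⟨h, h'⟩
      obtain ⟨y, h1, h2⟩ := ih.1 h'
      exact ⟨y, ⟨h, h1⟩, h2⟩
    · rintro ⟨y, ⟨h, h1⟩, h2⟩
      exact ⟨h, ih.2 ⟨y, h1, h2⟩⟩

@[simp] theorem org_rev (d : X.E × Bool) : X.org (X.rev d) = X.ter d := by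
  rcases d with ⟨e, _ | _⟩ <;> rfl

@[simp] theorem ter_rev (d : X.E × Bool) : X.ter (X.rev d) = X.org d := by
  rcases d with ⟨e, _ | _⟩ <;> rfl

@[simp] theorem rev_rev (d : X.E × Bool) : X.rev (X.rev d) = d := by
  rcases d with ⟨e, _ | _⟩ <;> rfl

/-- The reversed list of oriented 1-cells. -/
def revList (l : List (X.E × Bool)) : List (X.E × Bool) := (l.map X.rev).reverse

theorem isPath_revList {x y : X.V} {l : List (X.E × Bool)} (h : X.IsPath x l y) :
    X.IsPath y (revList l) x := by
  induction l generalizing x with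
  | nil => exact h.symm
  | cons d l ih =>
    have h2 : X.IsPath (X.ter d) [X.rev d] x :=
      ⟨org_rev d, (ter_rev d).trans h.1⟩
    have h3 := isPath_append (ih h.2) h2
    simpa [revList] using h3

namespace PathClass

/-- The class of an edge path. -/
def mk {x y : X.V} (l : List (X.E × Bool)) (h : X.IsPath x l y) : X.PathClass x y :=
  Quot.mk _ ⟨l, h⟩

theorem mk_backtrack {x y : X.V} (a b : List (X.E × Bool)) (d : X.E × Bool)
    (h : X.IsPath x (a ++ b) y) (h' : X.IsPath x (a ++ [d, X.rev d] ++ b) y) :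
    mk (a ++ [d, X.rev d] ++ b) h' = mk (a ++ b) h :=
  (Quot.sound ⟨a, _, b, rfl, rfl, Or.inl ⟨d, rfl⟩⟩).symm

theorem mk_face {x y : X.V} (a b : List (X.E × Bool)) (f : X.F)
    (h : X.IsPath x (a ++ b) y) (h' : X.IsPath x (a ++ X.bdry f ++ b) y) :
    mk (a ++ X.bdry f ++ b) h' = mk (a ++ b) h :=
  (Quot.sound ⟨a, _, b, rfl, rfl, Or.inr ⟨f, rfl⟩⟩).symm

/-- Concatenation of homotopy classes of edge paths. -/
def comp {x y z : X.V} : X.PathClass x y → X.PathClass y z → X.PathClass x z :=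
  Quot.map₂ (fun p q => ⟨p.1 ++ q.1, isPath_append p.2 q.2⟩)
    (by
      rintro p q q' ⟨a, m, b, h, h', hm⟩
      exact ⟨p.1 ++ a, m, b, by simp [h], by simp [h'], hm⟩)
    (by
      rintro p p' q ⟨a, m, b, h, h', hm⟩
      exact ⟨a, m, b ++ q.1, by simp [h], by simp [h'], hm⟩)

/-- The class of the constant path. -/
def refl (x : X.V) : X.PathClass x x := mk [] rfl

theorem comp_assoc {x y z t : X.V} (p : X.PathClass x y) (q : X.PathClass y z)
    (r : X.PathClass z t) : (p.comp q).comp r = p.comp (q.comp r) := by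
  rcases p with ⟨p, hp⟩
  rcases q with ⟨q, hq⟩
  rcases r with ⟨r, hr⟩
  change mk (p ++ q ++ r) _ = mk (p ++ (q ++ r)) _
  simp only [List.append_assoc]

theorem refl_comp {x y : X.V} (p : X.PathClass x y) : (refl x).comp p = p := by
  rcases p with ⟨p, hp⟩
  rfl

theorem comp_refl {x y : X.V} (p : X.PathClass x y) : p.comp (refl y) = p := by
  rcases p with ⟨p, hp⟩
  change mk (p ++ []) _ = mk p _
  simp only [List.append_nil]

theorem mk_revList_cancel {x y z t : X.V} (a b l : List (X.E × Bool)) (ha : X.IsPath x a y)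
    (hl : X.IsPath z l y) (hb : X.IsPath y b t) (h : X.IsPath x (a ++ revList l ++ l ++ b) t) :
    mk (a ++ revList l ++ l ++ b) h = mk (a ++ b) (isPath_append ha hb) := by
  induction l generalizing z with
  | nil => simp [revList]
  | cons d l ih =>
    have e1 : a ++ revList (d :: l) ++ d :: l ++ b
        = (a ++ revList l) ++ [X.rev d, X.rev (X.rev d)] ++ (l ++ b) := by
      simp [revList]
    have h1 : X.IsPath x (a ++ revList l ++ (l ++ b)) t :=
      isPath_append (isPath_append ha (isPath_revList hl.2)) (isPath_append hl.2 hb)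
    have h2 := h
    rw [e1] at h2
    calc mk _ h = mk _ h2 := by simp only [e1]
      _ = mk _ h1 := mk_backtrack _ _ _ h1 h2
      _ = mk (a ++ revList l ++ l ++ b) (by simpa using h1) := by
        simp only [List.append_assoc]
      _ = _ := ih hl.2 _

theorem revList_append (a b : List (X.E × Bool)) :
    revList (a ++ b) = revList b ++ revList a := by simp [revList]

/-- The inverse class, represented by the reversed path. -/
def inv {x y : X.V} : X.PathClass x y → X.PathClass y x :=
  Quot.lift (fun p => mk (revList p.1) (isPath_revList p.2)) (by
    rintro ⟨p, hp⟩ ⟨q, hq⟩ ⟨a, m, b, h, h', ⟨d, rfl⟩ | ⟨f, rfl⟩⟩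
    · dsimp only at h h'
      subst h h'
      have e1 : revList (a ++ [d, X.rev d] ++ b)
          = revList b ++ [d, X.rev d] ++ revList a := by simp [revList]
      have k1 := isPath_revList hp
      have k2 := isPath_revList hq
      rw [revList_append] at k1
      rw [e1] at k2
      have := mk_backtrack _ _ _ k1 k2
      simp only [e1, revList_append a b]
      exact this.symm
    · dsimp only at h h'
      subst h h'
      have e1 : revList (a ++ X.bdry f ++ b)
          = revList b ++ revList (X.bdry f) ++ revList a := by simp [revList]
      have k1 := isPath_revList hp
      have k2 := isPath_revList hq
      rw [revList_append] at k1
      rw [e1] at k2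
      obtain ⟨t, m1, m2⟩ := isPath_append_iff.1 hq
      obtain ⟨t', m3, m4⟩ := isPath_append_iff.1 m1
      have key : ∀ {x y z : X.V} {l : List (X.E × Bool)},
          X.IsPath x l y → X.IsPath x l z → y = z := by
        intro x y z l
        induction l generalizing x with
        | nil => intro i j; exact i.symm.trans j
        | cons d l ih => intro i j; exact ih i.2 j.2
      obtain ⟨rfl, rfl⟩ : t' = X.base f ∧ t = X.base f := by
        have ne := X.bdry_ne_nil f
        have c := X.bdry_closed f
        revert ne c m4
        cases X.bdry f with
        | nil => intro m4 ne; exact absurd rfl ne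
        | cons d l =>
          intro m4 _ c
          exact ⟨m4.1.symm.trans c.1, key m4.2 c.2⟩
      all_goals
        have n1 := isPath_revList m2
        have n2 := isPath_revList m3
        have k7 : X.IsPath y (revList b ++ revList (X.bdry f) ++ X.bdry f ++ revList a) x := by
          have := isPath_append (isPath_append (isPath_append n1
            (isPath_revList (X.bdry_closed f))) (X.bdry_closed f)) n2
          exact this
        have g1 := mk_revList_cancel (revList b) (revList a) (X.bdry f) n1 (X.bdry_closed f)
          n2 k7
        have g2 := mk_face (revList b ++ revList (X.bdry f)) (revList a) f k2 k7
        simp only [e1, revList_append a b]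
        exact g1.symm.trans g2)

theorem inv_comp {x y : X.V} (p : X.PathClass x y) : p.inv.comp p = refl y := by
  rcases p with ⟨p, hp⟩
  have h : X.IsPath y ([] ++ revList p ++ p ++ []) y := by
    simpa using isPath_append (isPath_revList hp) hp
  have := mk_revList_cancel [] [] p rfl hp rfl h
  change mk (revList p ++ p) _ = _
  simpa [refl] using this

/-- Transport along an equality of terminal 0-cells. -/
def cast {x y z : X.V} (p : X.PathClass x y) (h : y = z) : X.PathClass x z := h ▸ p

/-- The class of `p` followed by the oriented 1-cell `d`. -/
def snoc {x y : X.V} (p : X.PathClass x y) (d : X.E × Bool) (h : X.org d = y) :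
    X.PathClass x (X.ter d) :=
  p.comp (mk [d] ⟨h, rfl⟩)

theorem snoc_snoc_rev {x y : X.V} (p : X.PathClass x y) (d : X.E × Bool) (h : X.org d = y)
    (z : X.V) (hz : X.ter (X.rev d) = z) (hy : y = z) :
    p.comp (mk [d, X.rev d] ⟨h, org_rev d, hz⟩) = hy ▸ p := by
  subst hy
  rcases p with ⟨p, hp⟩
  have h1 : X.IsPath x (p ++ []) y := by simpa using hp
  have h2 : X.IsPath x (p ++ [d, X.rev d] ++ []) y := by
    simpa using isPath_append hp (m := [d, X.rev d]) ⟨h, org_rev d, hz⟩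
  have := mk_backtrack p [] d h1 h2
  simp only [List.append_nil] at this
  exact this

end PathClass

/-! ### The fundamental group and the universal cover -/

variable (X) (x₀ : X.V)

/-- The fundamental group of `X` at `x₀`. -/
def Pi1 : Type v := X.PathClass x₀ x₀

instance : Group (X.Pi1 x₀) where
  mul := PathClass.comp
  one := PathClass.refl x₀
  inv := PathClass.inv
  mul_assoc := PathClass.comp_assoc
  one_mul := PathClass.refl_comp
  mul_one := PathClass.comp_refl
  inv_mul_cancel := PathClass.inv_comp

/-- 0-cells of the universal cover: homotopy classes of edge paths starting at `x₀`. -/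
def CoverV : Type (max u v) := Σ x : X.V, X.PathClass x₀ x

/-- 1-cells of the universal cover: the lift of the 1-cell `e` whose initial 0-cell
is a given lift of `X.src e`. -/
def CoverE : Type v := Σ e : X.E, X.PathClass x₀ (X.src e)

/-- 2-cells of the universal cover: the lift of the 2-cell `f` whose boundary path
starts at a given lift of `X.base f`. -/
def CoverF : Type (max v w) := Σ f : X.F, X.PathClass x₀ (X.base f)

/-! The fundamental group acts on the universal cover (by deck transformations). -/

instance : MulAction (X.Pi1 x₀) (X.CoverV x₀) where
  smul g a := ⟨a.1, PathClass.comp g a.2⟩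
  one_smul a := Sigma.ext rfl (heq_of_eq (PathClass.refl_comp a.2))
  mul_smul g h a := Sigma.ext rfl (heq_of_eq (PathClass.comp_assoc g h a.2))

instance : MulAction (X.Pi1 x₀) (X.CoverE x₀) where
  smul g a := ⟨a.1, PathClass.comp g a.2⟩
  one_smul a := Sigma.ext rfl (heq_of_eq (PathClass.refl_comp a.2))
  mul_smul g h a := Sigma.ext rfl (heq_of_eq (PathClass.comp_assoc g h a.2))

instance : MulAction (X.Pi1 x₀) (X.CoverF x₀) where
  smul g a := ⟨a.1, PathClass.comp g a.2⟩
  one_smul a := Sigma.ext rfl (heq_of_eq (PathClass.refl_comp a.2))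
  mul_smul g h a := Sigma.ext rfl (heq_of_eq (PathClass.comp_assoc g h a.2))

variable {X x₀}

/-- The lift of an oriented 1-cell `d` that starts at the 0-cell `c` of the universal cover. -/
def liftEdge {y : X.V} (c : X.PathClass x₀ y) :
    (d : X.E × Bool) → X.org d = y → X.CoverE x₀ × Bool
  | (e, true), h => (⟨e, c.cast h.symm⟩, true)
  | (e, false), h => (⟨e, c.snoc (e, false) h⟩, false)

/-- The lift of an edge path of `X` that starts at the 0-cell `c` of the universal cover. -/
def liftPath : (l : List (X.E × Bool)) → {y z : X.V} → X.PathClass x₀ y → X.IsPath y l z →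
    List (X.CoverE x₀ × Bool)
  | [], _, _, _, _ => []
  | d :: l, _, _, c, h => liftEdge c d h.1 :: liftPath l (c.snoc d h.1) h.2

variable (X x₀)

/-- The cells of the universal cover with their incidences. -/
def preCover : PreTwoComplex.{max u v, v, max v w} where
  V := X.CoverV x₀
  E := X.CoverE x₀
  F := X.CoverF x₀
  src a := ⟨X.src a.1, a.2⟩
  tgt a := ⟨X.tgt a.1, a.2.snoc (a.1, true) rfl⟩
  base r := ⟨X.base r.1, r.2⟩
  bdry r := liftPath (X.bdry r.1) r.2 (X.bdry_closed r.1)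

variable {X x₀}

theorem org_liftEdge {y : X.V} (c : X.PathClass x₀ y) (d : X.E × Bool) (h : X.org d = y) :
    (X.preCover x₀).org (liftEdge c d h) = ⟨y, c⟩ := by
  subst h
  rcases d with ⟨e, _ | _⟩
  · change (⟨X.tgt e, (c.snoc (e, false) rfl).snoc (e, true) rfl⟩ : X.CoverV x₀) = ⟨X.tgt e, c⟩
    refine Sigma.ext rfl (heq_of_eq ?_)
    refine (PathClass.comp_assoc _ _ _).trans ?_
    exact PathClass.snoc_snoc_rev c (e, false) rfl (X.tgt e) rfl rfl
  · rfl

theorem ter_liftEdge {y : X.V} (c : X.PathClass x₀ y) (d : X.E × Bool) (h : X.org d = y) :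
    (X.preCover x₀).ter (liftEdge c d h) = ⟨X.ter d, c.snoc d h⟩ := by
  subst h
  rcases d with ⟨e, _ | _⟩ <;> rfl

theorem isPath_liftPath (l : List (X.E × Bool)) {y z : X.V} (c : X.PathClass x₀ y)
    (h : X.IsPath y l z) :
    (X.preCover x₀).IsPath ⟨y, c⟩ (liftPath l c h) ⟨z, c.comp (PathClass.mk l h)⟩ := by
  induction l generalizing y with
  | nil =>
    cases h
    exact Sigma.ext rfl (heq_of_eq (PathClass.comp_refl c).symm)
  | cons d l ih =>
    refine ⟨org_liftEdge c d h.1, ?_⟩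
    rw [ter_liftEdge]
    have h1 := ih (c.snoc d h.1) h.2
    have h2 : (c.snoc d h.1).comp (PathClass.mk l h.2) = c.comp (PathClass.mk (d :: l) h) :=
      PathClass.comp_assoc _ _ _
    rw [h2] at h1
    exact h1

variable (X x₀)

/-- The universal cover of `X` (of the component of `x₀`). -/
def univCover : TwoComplex.{max u v, v, max v w} where
  toPreTwoComplex := X.preCover x₀
  bdry_ne_nil := by
    rintro ⟨f, c⟩
    have ne := X.bdry_ne_nil f
    change liftPath (X.bdry f) c (X.bdry_closed f) ≠ []
    generalize X.bdry_closed f = k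
    revert ne k
    cases X.bdry f with
    | nil => intro ne; exact absurd rfl ne
    | cons d l => intro _ k; exact List.cons_ne_nil _ _
  bdry_closed := by
    rintro ⟨f, c⟩
    have h := isPath_liftPath (X.bdry f) c (X.bdry_closed f)
    have h2 : c.comp (PathClass.mk (X.bdry f) (X.bdry_closed f)) = c := by
      rcases c with ⟨p, hp⟩
      have k1 : X.IsPath x₀ (p ++ []) (X.base f) := by simpa using hp
      have k2 : X.IsPath x₀ (p ++ X.bdry f ++ []) (X.base f) := by
        simpa using isPath_append hp (X.bdry_closed f)
      have := PathClass.mk_face p [] f k1 k2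
      simp only [List.append_nil] at this
      exact this
    rw [h2] at h
    exact h

/-! ### Bislim complexes -/

/-- A bislim structure on `X`: an invariant preorder `le` on the 1-cells of the universal cover,
and an equivariant choice of distinguished 1-cells `r⁺ = plus r` and `r⁻ = minus r` in the boundary
of every 2-cell `r` of the universal cover. -/
structure BislimStructure where
  le : X.CoverE x₀ → X.CoverE x₀ → Prop
  le_refl : ∀ a, le a a
  le_trans : ∀ a b c, le a b → le b c → le a c
  le_smul : ∀ (g : X.Pi1 x₀) (a b), le a b → le (g • a) (g • b)
  plus : X.CoverF x₀ → X.CoverE x₀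
  minus : X.CoverF x₀ → X.CoverE x₀
  plus_mem : ∀ r, (X.univCover x₀).OnBoundary (plus r) r
  minus_mem : ∀ r, (X.univCover x₀).OnBoundary (minus r) r
  plus_once : ∀ r, (X.univCover x₀).TraversedOnce (plus r) r
  plus_smul : ∀ (g : X.Pi1 x₀) (r), plus (g • r) = g • plus r
  minus_smul : ∀ (g : X.Pi1 x₀) (r), minus (g • r) = g • minus r
  /-- if `r₁ ≠ r₂` and `r₁⁺` lies in the boundary of `r₂`, then `r₁⁺ ≺ r₂⁺` -/
  plus_lt : ∀ r₁ r₂, r₁ ≠ r₂ → (X.univCover x₀).OnBoundary (plus r₁) r₂ →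
    le (plus r₁) (plus r₂) ∧ ¬ le (plus r₂) (plus r₁)
  /-- if `r₁ ≠ r₂` and `r₂⁻` lies in the boundary of `r₁`, then `r₁⁺ ≺ r₂⁺` -/
  minus_lt : ∀ r₁ r₂, r₁ ≠ r₂ → (X.univCover x₀).OnBoundary (minus r₂) r₁ →
    le (plus r₁) (plus r₂) ∧ ¬ le (plus r₂) (plus r₁)

/-- `X` is bislim: the attaching maps of its 2-cells are immersed and it has a bislim structure. -/
def IsBislim : Prop := X.Immersed ∧ Nonempty (X.BislimStructure x₀)

end TwoComplex

/-! ### Free groups have unique products -/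

/-! If a 2-cell fails to embed, a proper nonempty subpath of its boundary path is closed: cut at a
repeated 0-cell, or between two opposite traversals of a 1-cell, which immersion keeps from being
adjacent. In the free group on the 1-cells of the universal cover, a closed path is a product of
conjugates of boundary words (`mk_mem_boundaryNormalClosure`). So it suffices that no proper
nonempty subword of a boundary word lies in their normal closure
(`mk_notMem_normalClosure_of_infix`).

Only finitely many relators are involved. Solving each for its letter `plus` shows that their normal
closure is the kernel of an endomorphism `ρ` of the free group
(`exists_endomorphism_ker_eq_normalClosure`), so Fox derivatives can take coefficients in the group
ring of a free group, which has no zero divisors by unique products. The derivative of a trivial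
subword `a` of `w s` is then a combination of the derivatives of relators (`fox_mem_span`).

Take `s` lowest and `a` shortest, avoiding `plus s`. Among the relators with nonzero coefficient,
let `v` be minimal and `u` maximal above `v`. The letter `plus u` occurs in no other of them, so it
survives in `a`, whence `plus v ≤ plus u < plus s`. Then `w v` has no trivial proper subword, its
derivative at `minus v` is nonzero (`fox_ne_zero`), and `minus v` likewise survives in `a`. This
gives `plus s < plus v`, a contradiction. -/

theorem FreeGroup.exists_additive_on_closure {α : Type*} (T : Set (FreeGroup α))
    (hT : ∃ t ∈ T, t ≠ 1) :
    ∃ ψ : FreeGroup α → ℤ,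
      (∀ x ∈ Subgroup.closure T, ∀ y ∈ Subgroup.closure T, ψ (x * y) = ψ x + ψ y) ∧
        ∃ t ∈ T, ψ t ≠ 0 := by
  classical
  set K := Subgroup.closure T with hK
  -- By Nielsen–Schreier `K` is free; as it is nontrivial it has a basis element, and every basis
  -- element can be sent to the generator of ℤ.
  obtain ⟨φ, hφ⟩ : ∃ φ : K →* Multiplicative ℤ, φ ≠ 1 := by
    have b := IsFreeGroup.basis K
    by_cases hi : Nonempty (IsFreeGroup.Generators K)
    · refine ⟨b.lift fun _ => Multiplicative.ofAdd 1, fun h => ?_⟩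
      have h1 := DFunLike.congr_fun h (b hi.some)
      simp at h1
    · obtain ⟨t, ht, ht1⟩ := hT
      have : IsEmpty (IsFreeGroup.Generators K) := not_nonempty_iff.1 hi
      have h2 : b.repr ⟨t, Subgroup.subset_closure ht⟩ = b.repr 1 := Subsingleton.elim _ _
      exact absurd (congrArg Subtype.val (b.repr.injective h2)) ht1
  refine ⟨fun x => if h : x ∈ K then (φ ⟨x, h⟩).toAdd else 0, ?_, ?_⟩
  · intro x hx y hy
    have hxy := K.mul_mem hx hy
    have : (⟨x * y, hxy⟩ : K) = ⟨x, hx⟩ * ⟨y, hy⟩ := rfl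
    simp only [dif_pos hx, dif_pos hy, dif_pos hxy]
    rw [this, MonoidHom.map_mul]; rfl
  · by_contra! hc
    refine hφ (MonoidHom.ext fun x => ?_)
    obtain ⟨x, hx⟩ := x
    induction hx using Subgroup.closure_induction with
    | mem t ht =>
      have h1 := hc t ht
      have h2 : t ∈ K := Subgroup.subset_closure ht
      rw [dif_pos h2] at h1
      exact h1
    | one => exact MonoidHom.map_one φ
    | mul x y hx hy ihx ihy =>
      have : (⟨x * y, K.mul_mem hx hy⟩ : K) = ⟨x, hx⟩ * ⟨y, hy⟩ := rfl
      rw [this, MonoidHom.map_mul, ihx, ihy]; rfl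
    | inv x hx ih =>
      have : (⟨x⁻¹, K.inv_mem hx⟩ : K) = ⟨x, hx⟩⁻¹ := rfl
      rw [this, MonoidHom.map_inv, ih]; rfl

/-- Local indicability gives unique products: after translating both sets to contain 1, a nonzero
additive map on the subgroup they generate isolates its top fibres, and a unique product of these is
one of `A` and `B`. -/
theorem FreeGroup.exists_uniqueMul {α : Type*} (n : ℕ) (A B : Finset (FreeGroup α))
    (hA : A.Nonempty) (hB : B.Nonempty) (hn : A.card + B.card ≤ n) :
    ∃ a ∈ A, ∃ b ∈ B, UniqueMul A B a b := by
  classical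
  induction n generalizing A B with
  | zero => have := hA.card_pos; omega
  | succ n ih =>
    obtain ⟨a₀, ha₀⟩ := hA
    obtain ⟨b₀, hb₀⟩ := hB
    by_cases hT : ∃ t ∈ {t | (∃ a ∈ A, t = a₀⁻¹ * a) ∨ ∃ b ∈ B, t = b * b₀⁻¹}, t ≠ 1
    · obtain ⟨ψ, hψ, t, ht, htψ⟩ := FreeGroup.exists_additive_on_closure _ hT
      set T : Set (FreeGroup α) := {t | (∃ a ∈ A, t = a₀⁻¹ * a) ∨ ∃ b ∈ B, t = b * b₀⁻¹}
      have hone : ψ 1 = 0 := by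
        have := hψ 1 (Subgroup.one_mem _) 1 (Subgroup.one_mem _)
        simpa using this
      have mA : ∀ a ∈ A, a₀⁻¹ * a ∈ Subgroup.closure T := fun a ha =>
        Subgroup.subset_closure (Or.inl ⟨a, ha, rfl⟩)
      have mB : ∀ b ∈ B, b * b₀⁻¹ ∈ Subgroup.closure T := fun b hb =>
        Subgroup.subset_closure (Or.inr ⟨b, hb, rfl⟩)
      -- The sign `s` makes some value positive. Since `ψ 1 = 0`, the top fibre of that set then
      -- omits `a₀` or `b₀`, so the total size drops.
      have key : ∀ (s : ℤ), s = 1 ∨ s = -1 →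
          (∃ c ∈ A, 0 < s * ψ (a₀⁻¹ * c)) ∨ (∃ c ∈ B, 0 < s * ψ (c * b₀⁻¹)) →
          ∃ a ∈ A, ∃ b ∈ B, UniqueMul A B a b := by
        intro s hs hpos
        have hs0 : s ≠ 0 := by rcases hs with rfl | rfl <;> decide
        obtain ⟨a₁, ha₁, hmA⟩ := A.exists_max_image (fun a => s * ψ (a₀⁻¹ * a)) ⟨a₀, ha₀⟩
        obtain ⟨b₁, hb₁, hmB⟩ := B.exists_max_image (fun b => s * ψ (b * b₀⁻¹)) ⟨b₀, hb₀⟩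
        set A' := A.filter fun a => ψ (a₀⁻¹ * a) = ψ (a₀⁻¹ * a₁)
        set B' := B.filter fun b => ψ (b * b₀⁻¹) = ψ (b₁ * b₀⁻¹)
        have cA : A'.card ≤ A.card := Finset.card_filter_le _ _
        have cB : B'.card ≤ B.card := Finset.card_filter_le _ _
        have hlt : A'.card + B'.card ≤ n := by
          rcases hpos with ⟨c, hc, hp⟩ | ⟨c, hc, hp⟩
          · have : A'.card < A.card := by
              refine Finset.card_lt_card (Finset.filter_ssubset.2 ⟨a₀, ha₀, fun h => ?_⟩)
              have := hmA c hc
              rw [← h] at this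
              simp [hone] at this
              omega
            omega
          · have : B'.card < B.card := by
              refine Finset.card_lt_card (Finset.filter_ssubset.2 ⟨b₀, hb₀, fun h => ?_⟩)
              have := hmB c hc
              rw [← h] at this
              simp [hone] at this
              omega
            omega
        obtain ⟨a, ha, b, hb, hu⟩ := ih A' B' ⟨a₁, by simp [A', ha₁]⟩ ⟨b₁, by simp [B', hb₁]⟩ hlt
        obtain ⟨ha, hae⟩ := Finset.mem_filter.1 ha
        obtain ⟨hb, hbe⟩ := Finset.mem_filter.1 hb
        refine ⟨a, ha, b, hb, fun x y hx hy hxy => ?_⟩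
        have e1 : (a₀⁻¹ * x) * (y * b₀⁻¹) = (a₀⁻¹ * a) * (b * b₀⁻¹) := by
          calc _ = a₀⁻¹ * (x * y) * b₀⁻¹ := by group
            _ = a₀⁻¹ * (a * b) * b₀⁻¹ := by rw [hxy]
            _ = _ := by group
        have e2 := congrArg ψ e1
        rw [hψ _ (mA x hx) _ (mB y hy), hψ _ (mA a ha) _ (mB b hb), hae, hbe] at e2
        have i1 := hmA x hx
        have i2 := hmB y hy
        -- Two summands bounded by their maxima and adding up to the sum of the maxima must both be
        -- maximal.
        have e3 : ψ (a₀⁻¹ * x) = ψ (a₀⁻¹ * a₁) ∧ ψ (y * b₀⁻¹) = ψ (b₁ * b₀⁻¹) := by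
          rcases hs with rfl | rfl <;> constructor <;> linarith
        exact hu (Finset.mem_filter.2 ⟨hx, e3.1⟩) (Finset.mem_filter.2 ⟨hy, e3.2⟩) hxy
      rcases lt_or_gt_of_ne htψ with h | h
      · refine key (-1) (Or.inr rfl) ?_
        rcases ht with ⟨a, ha, rfl⟩ | ⟨b, hb, rfl⟩
        · exact Or.inl ⟨a, ha, by linarith⟩
        · exact Or.inr ⟨b, hb, by linarith⟩
      · refine key 1 (Or.inl rfl) ?_
        rcases ht with ⟨a, ha, rfl⟩ | ⟨b, hb, rfl⟩
        · exact Or.inl ⟨a, ha, by linarith⟩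
        · exact Or.inr ⟨b, hb, by linarith⟩
    · push Not at hT
      refine ⟨a₀, ha₀, b₀, hb₀, fun a b ha hb _ => ⟨?_, ?_⟩⟩
      · exact (inv_mul_eq_one.1 (hT _ (Or.inl ⟨a, ha, rfl⟩))).symm
      · exact mul_inv_eq_one.1 (hT _ (Or.inr ⟨b, hb, rfl⟩))

/-- This makes ℤ[F] free of zero divisors, so that a nonzero coefficient times a nonzero derivative
is nonzero. -/
instance FreeGroup.instUniqueProds {α : Type*} : UniqueProds (FreeGroup α) where
  uniqueMul_of_nonempty hA hB := FreeGroup.exists_uniqueMul _ _ _ hA hB le_rfl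

/-! ### Normal closures of collapsible families of relators -/

namespace FoxCalculus

theorem lift_mk_of_forall {E : Type*} (f : E → FreeGroup E) (l : List (E × Bool))
    (h : ∀ d ∈ l, f d.1 = FreeGroup.of d.1) : FreeGroup.lift f (FreeGroup.mk l) = FreeGroup.mk l := by
  induction l with
  | nil => exact map_one (FreeGroup.lift f)
  | cons d l ih =>
    have e : (FreeGroup.mk (d :: l) : FreeGroup E) = FreeGroup.mk [d] * FreeGroup.mk l := rfl
    have h1 : FreeGroup.lift f (FreeGroup.mk [d]) = FreeGroup.mk [d] := by
      rcases d with ⟨a, _ | _⟩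
      · have := h (a, false) (by simp)
        simp only [FreeGroup.lift_mk, List.map_cons, List.map_nil, List.prod_singleton, cond_false,
          this]
        rfl
      · have := h (a, true) (by simp)
        simp only [FreeGroup.lift_mk, List.map_cons, List.map_nil, List.prod_singleton, cond_true,
          this]
        rfl
    rw [e, map_mul, h1, ih fun d hd => h d (by simp [hd])]

/-- If every relator contains its distinguished letter exactly once, and the distinguished letter
of a relator occurs in other relators only if these have a larger distinguished letter, then the
normal closure of finitely many relators is the kernel of an endomorphism of the free group. -/
theorem exists_endomorphism_ker_eq_normalClosure {E F : Type*} [Preorder E]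
    (w : F → List (E × Bool)) (plus : F → E)
    (hplus : ∀ s, ∃ p d q, w s = p ++ d :: q ∧ d.1 = plus s ∧ ∀ x ∈ p ++ q, x.1 ≠ plus s)
    (hlt : ∀ s t, s ≠ t → (∃ d ∈ w t, d.1 = plus s) → plus s < plus t) (S : Finset F) :
    ∃ ρ : FreeGroup E →* FreeGroup E,
      ∀ x, ρ x = 1 ↔ x ∈ Subgroup.normalClosure ((fun s => FreeGroup.mk (w s)) '' (S : Set F)) := by
  classical
  -- Killing the relators puts the normal closure in the kernel; being the identity modulo the
  -- normal closure gives the converse.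
  suffices H : ∃ ρ : FreeGroup E →* FreeGroup E, (∀ s ∈ S, ρ (FreeGroup.mk (w s)) = 1) ∧
      ∀ x, (ρ x)⁻¹ * x ∈
        Subgroup.normalClosure ((fun s => FreeGroup.mk (w s)) '' (S : Set F)) by
    obtain ⟨ρ, h1, h2⟩ := H
    refine ⟨ρ, fun x => ⟨fun h => by simpa [h] using h2 x, fun h => ?_⟩⟩
    have : Subgroup.normalClosure ((fun s => FreeGroup.mk (w s)) '' (S : Set F)) ≤ ρ.ker := by
      refine Subgroup.normalClosure_le_normal ?_
      rintro _ ⟨s, hs, rfl⟩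
      exact h1 s hs
    exact this h
  induction hn : S.card generalizing S with
  | zero =>
    obtain rfl := Finset.card_eq_zero.1 hn
    exact ⟨MonoidHom.id _, by simp, fun x => by simp⟩
  | succ n ih =>
    have hS : S.Nonempty := Finset.card_pos.1 (by omega)
    obtain ⟨s, hs, hmax⟩ := S.exists_maximalFor plus hS
    obtain ⟨ρ, h1, h2⟩ := ih (S.erase s) (by rw [Finset.card_erase_of_mem hs]; omega)
    obtain ⟨p, d, q, hw, hd, hpq⟩ := hplus s
    -- The solution of `w s = 1` for the letter `plus s`, according to the sign with which it
    -- occurs. By maximality of `plus s`, substituting it leaves the other relators of `S`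
    -- unchanged.
    set c : FreeGroup E := cond d.2 ((FreeGroup.mk p)⁻¹ * (FreeGroup.mk q)⁻¹)
      (FreeGroup.mk q * FreeGroup.mk p) with hc
    set σ : FreeGroup E →* FreeGroup E :=
      FreeGroup.lift fun e => if e = plus s then c else FreeGroup.of e with hσ
    have hfix : ∀ l : List (E × Bool), (∀ x ∈ l, x.1 ≠ plus s) →
        σ (FreeGroup.mk l) = FreeGroup.mk l := fun l hl =>
      lift_mk_of_forall _ _ fun d hd => if_neg (hl d hd)
    have hws : FreeGroup.mk (w s) = FreeGroup.mk p * FreeGroup.mk [d] * FreeGroup.mk q := by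
      rw [hw]; simp [FreeGroup.mul_mk]
    have hσs : σ (FreeGroup.mk (w s)) = 1 := by
      rw [hws, map_mul, map_mul, hfix p fun x hx => hpq x (by simp [hx]),
        hfix q fun x hx => hpq x (by simp [hx])]
      have : σ (FreeGroup.mk [d]) = (FreeGroup.mk p)⁻¹ * (FreeGroup.mk q)⁻¹ := by
        rcases d with ⟨e, _ | _⟩
        · simp only at hd
          simp [hσ, FreeGroup.lift_mk, hd, hc]
        · simp only at hd
          simp [hσ, FreeGroup.lift_mk, hd, hc]
      rw [this]; group
    set N := Subgroup.normalClosure ((fun s => FreeGroup.mk (w s)) '' (S : Set F)) with hN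
    have hle : Subgroup.normalClosure
        ((fun s => FreeGroup.mk (w s)) '' ((S.erase s : Finset F) : Set F)) ≤ N :=
      Subgroup.normalClosure_mono (Set.image_mono (by simp))
    have hmem : FreeGroup.mk (w s) ∈ N := Subgroup.subset_normalClosure ⟨s, hs, rfl⟩
    have hσN : (QuotientGroup.mk' N).comp σ = QuotientGroup.mk' N := by
      refine FreeGroup.ext_hom _ _ fun e => ?_
      by_cases he : e = plus s
      · subst he
        have h3 : QuotientGroup.mk' N (FreeGroup.mk (w s)) = 1 :=
          (QuotientGroup.eq_one_iff _).2 hmem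
        rw [hws, map_mul, map_mul] at h3
        have h4 : σ (FreeGroup.of (plus s)) = c := by simp [hσ]
        rw [MonoidHom.comp_apply, h4]
        rcases d with ⟨e, _ | _⟩
        · simp only at hd
          subst hd
          have h5 : (FreeGroup.mk [(plus s, false)] : FreeGroup E) = (FreeGroup.of (plus s))⁻¹ := rfl
          rw [h5, map_inv, mul_assoc, mul_eq_one_iff_eq_inv] at h3
          rw [hc]
          simp only [cond_false, map_mul]
          rw [h3]; group
        · simp only at hd
          subst hd
          have h5 : (FreeGroup.mk [(plus s, true)] : FreeGroup E) = FreeGroup.of (plus s) := rfl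
          rw [h5, mul_assoc, mul_eq_one_iff_eq_inv] at h3
          rw [hc]
          simp only [cond_true, map_mul, map_inv]
          rw [h3]; group
      · simp [hσ, he]
    refine ⟨ρ.comp σ, fun t ht => ?_, fun x => ?_⟩
    · by_cases hts : t = s
      · subst hts
        rw [MonoidHom.comp_apply, hσs, map_one]
      · rw [MonoidHom.comp_apply, hfix, h1 t (Finset.mem_erase.2 ⟨hts, ht⟩)]
        intro x hx hxs
        have := hlt s t (Ne.symm hts) ⟨x, hx, hxs⟩
        exact this.not_ge (hmax ht this.le)
    · have h3 := hle (h2 (σ x))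
      have h4 : (σ x)⁻¹ * x ∈ N := QuotientGroup.eq.1 (DFunLike.congr_fun hσN x)
      have := N.mul_mem h3 h4
      simpa [mul_assoc] using this

end FoxCalculus

/-! ### Twisted Fox derivatives -/

namespace FoxCalculus

variable {E : Type*}

open Classical in
/-- The affine action of the free group on `E → ℤ[F(E)]` whose linear part is left multiplication
through `ρ` and whose translation part is the Fox derivative. -/
noncomputable def affineAction (ρ : FreeGroup E →* FreeGroup E) :
    FreeGroup E →* Equiv.Perm (E → MonoidAlgebra ℤ (FreeGroup E)) :=
  FreeGroup.lift fun e =>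
    { toFun := fun z => Pi.single e 1 + MonoidAlgebra.of ℤ _ (ρ (FreeGroup.of e)) • z
      invFun := fun z => MonoidAlgebra.of ℤ _ (ρ (FreeGroup.of e))⁻¹ • (z - Pi.single e 1)
      left_inv := fun z => by
        beta_reduce
        rw [add_sub_cancel_left, smul_smul, ← map_mul, inv_mul_cancel, map_one, one_smul]
      right_inv := fun z => by
        beta_reduce
        rw [smul_smul, ← map_mul, mul_inv_cancel, map_one, one_smul, add_sub_cancel] }

/-- The total Fox derivative of `x`, with coefficients twisted by `ρ`. -/
noncomputable def fox (ρ : FreeGroup E →* FreeGroup E) (x : FreeGroup E) :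
    E → MonoidAlgebra ℤ (FreeGroup E) :=
  affineAction ρ x 0

variable (ρ : FreeGroup E →* FreeGroup E)

open Classical in
theorem affineAction_of (e : E) (z : E → MonoidAlgebra ℤ (FreeGroup E)) :
    affineAction ρ (FreeGroup.of e) z =
      Pi.single e 1 + MonoidAlgebra.of ℤ _ (ρ (FreeGroup.of e)) • z := by
  simp [affineAction]

/-- Composing affine maps turns this into the product rule `fox_mul`. -/
theorem affineAction_apply (x : FreeGroup E) (z : E → MonoidAlgebra ℤ (FreeGroup E)) :
    affineAction ρ x z = fox ρ x + MonoidAlgebra.of ℤ _ (ρ x) • z := by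
  classical
  induction x using FreeGroup.induction_on generalizing z with
  | C1 => rw [fox, map_one, map_one, map_one, one_smul, Equiv.Perm.one_apply, Equiv.Perm.one_apply, zero_add]
  | of e => rw [fox, affineAction_of, affineAction_of, smul_zero, add_zero]
  | inv_of e _ =>
    have h : ∀ z, affineAction ρ (FreeGroup.of e)⁻¹ z =
        MonoidAlgebra.of ℤ _ (ρ (FreeGroup.of e))⁻¹ • (z - Pi.single e 1) := fun z => by
      rw [map_inv, Equiv.Perm.inv_eq_iff_eq, affineAction_of, smul_smul, ← map_mul,
        mul_inv_cancel, map_one, one_smul, add_sub_cancel]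
    rw [fox, h, h, map_inv ρ, ← smul_add]
    congr 1
    abel
  | mul x y hx hy =>
    rw [fox, map_mul, Equiv.Perm.mul_apply, Equiv.Perm.mul_apply, hy, hx, hy 0, hx (_ + _), smul_zero,
      add_zero, map_mul, map_mul, smul_add, smul_smul, add_assoc]

theorem fox_one : fox ρ 1 = 0 := by simp [fox]

theorem fox_mul (x y : FreeGroup E) :
    fox ρ (x * y) = fox ρ x + MonoidAlgebra.of ℤ _ (ρ x) • fox ρ y := by
  rw [fox, map_mul, Equiv.Perm.mul_apply, affineAction_apply]; rfl

theorem fox_inv (x : FreeGroup E) :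
    fox ρ x⁻¹ = -(MonoidAlgebra.of ℤ _ (ρ x)⁻¹ • fox ρ x) := by
  have h := fox_mul ρ x⁻¹ x
  rw [inv_mul_cancel, fox_one, map_inv] at h
  exact eq_neg_of_add_eq_zero_left h.symm

open Classical in
theorem fox_of (e : E) : fox ρ (FreeGroup.of e) = Pi.single e 1 := by
  rw [fox, affineAction_of, smul_zero, add_zero]

/-- As `ρ` kills a relator, the contributions of `g` and `g⁻¹` to the derivative of its conjugate
cancel, leaving a left multiple of the relator's derivative. -/
theorem fox_mem_span {F : Type*} (r : F → FreeGroup E) (S : Set F) (hr : ∀ s ∈ S, ρ (r s) = 1)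
    {x : FreeGroup E} (hx : x ∈ Subgroup.normalClosure (r '' S)) :
    ρ x = 1 ∧ fox ρ x ∈ Submodule.span (MonoidAlgebra ℤ (FreeGroup E))
      ((fun s => fox ρ (r s)) '' S) := by
  induction hx using Subgroup.closure_induction with
  | mem y hy =>
    obtain ⟨_, ⟨s, hs, rfl⟩, hy⟩ := Group.mem_conjugatesOfSet_iff.1 hy
    obtain ⟨g, rfl⟩ := isConj_iff.1 hy
    refine ⟨by simp [hr s hs], ?_⟩
    have : fox ρ (g * r s * g⁻¹) = MonoidAlgebra.of ℤ _ (ρ g) • fox ρ (r s) := by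
      rw [fox_mul, fox_mul, fox_inv, map_mul, hr s hs, mul_one, smul_neg, smul_smul, ← map_mul,
        mul_inv_cancel, map_one, one_smul]
      abel
    rw [this]
    exact Submodule.smul_mem _ _ (Submodule.subset_span ⟨s, hs, rfl⟩)
  | one => exact ⟨map_one ρ, by rw [fox_one]; exact Submodule.zero_mem _⟩
  | mul x y _ _ hx hy =>
    refine ⟨by rw [map_mul, hx.1, hy.1, one_mul], ?_⟩
    rw [fox_mul]
    exact Submodule.add_mem _ hx.2 (Submodule.smul_mem _ _ hy.2)
  | inv x _ hx =>
    refine ⟨by rw [map_inv, hx.1, inv_one], ?_⟩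
    rw [fox_inv]
    exact Submodule.neg_mem _ (Submodule.smul_mem _ _ hx.2)

/-! ### Reading Fox derivatives off words, and their nonvanishing -/

/-- The initial point, in the cover defined by `ρ`, of the unoriented letter read after `p`. -/
def position (p : List (E × Bool)) (d : E × Bool) : FreeGroup E :=
  cond d.2 (ρ (FreeGroup.mk p)) (ρ (FreeGroup.mk (p ++ [d])))

open Classical in
theorem fox_letter (d : E × Bool) (e : E) :
    fox ρ (FreeGroup.mk [d]) e =
      if d.1 = e then MonoidAlgebra.single (position ρ [] d) (cond d.2 1 (-1)) else 0 := by
  rcases d with ⟨a, _ | _⟩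
  · have h5 : (FreeGroup.mk [(a, false)] : FreeGroup E) = (FreeGroup.of a)⁻¹ := rfl
    rw [h5, fox_inv, fox_of]
    by_cases h : a = e
    · subst h
      simp [position, h5]
    · simp [h, Ne.symm h]
  · have h5 : (FreeGroup.mk [(a, true)] : FreeGroup E) = FreeGroup.of a := rfl
    have h6 : (FreeGroup.mk [] : FreeGroup E) = 1 := rfl
    rw [h5, fox_of]
    by_cases h : a = e
    · subst h
      simp [position, h6, MonoidAlgebra.one_def]
    · simp [h, Ne.symm h]

theorem fox_mk_append (p q : List (E × Bool)) :
    fox ρ (FreeGroup.mk (p ++ q)) =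
      fox ρ (FreeGroup.mk p) + MonoidAlgebra.of ℤ _ (ρ (FreeGroup.mk p)) • fox ρ (FreeGroup.mk q) := by
  rw [← FreeGroup.mul_mk, fox_mul]

theorem position_append (p q : List (E × Bool)) (d : E × Bool) :
    position ρ (p ++ q) d = ρ (FreeGroup.mk p) * position ρ q d := by
  rcases d with ⟨a, _ | _⟩
  · simp only [position, cond_false, ← map_mul, FreeGroup.mul_mk, List.append_assoc]
  · simp only [position, cond_true, ← map_mul, FreeGroup.mul_mk]

/-- By the product rule each occurrence of `e` contributes ±1 at its own position and nothing else
contributes. -/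
theorem exists_eq_position (l : List (E × Bool)) (e : E) (g : FreeGroup E)
    (h : (fox ρ (FreeGroup.mk l) e).coeff g ≠ 0) :
    ∃ p d q, l = p ++ d :: q ∧ d.1 = e ∧ g = position ρ p d := by
  classical
  induction l generalizing g with
  | nil =>
    have h6 : (FreeGroup.mk [] : FreeGroup E) = 1 := rfl
    simp [h6, fox_one] at h
  | cons d l ih =>
    rw [← List.singleton_append, fox_mk_append, Pi.add_apply, Pi.smul_apply, smul_eq_mul,
      MonoidAlgebra.of_apply, MonoidAlgebra.coeff_add, Finsupp.add_apply] at h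
    by_cases h1 : (fox ρ (FreeGroup.mk [d]) e).coeff g = 0
    · rw [h1, zero_add, MonoidAlgebra.coeff_single_mul_apply, one_mul] at h
      obtain ⟨p, d', q, rfl, hd, hg⟩ := ih _ h
      refine ⟨d :: p, d', q, rfl, hd, ?_⟩
      rw [← List.singleton_append, position_append, ← hg, mul_inv_cancel_left]
    · rw [fox_letter] at h1
      by_cases hd : d.1 = e
      · refine ⟨[], d, l, rfl, hd, ?_⟩
        rw [if_pos hd, MonoidAlgebra.coeff_single, Finsupp.single_apply] at h1
        by_contra hg
        exact h1 (if_neg (Ne.symm hg))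
      · simp [hd] at h1

theorem exists_mem_of_fox_ne_zero {l : List (E × Bool)} {e : E} (h : fox ρ (FreeGroup.mk l) e ≠ 0) :
    ∃ d ∈ l, d.1 = e := by
  obtain ⟨g, hg⟩ : ∃ g, (fox ρ (FreeGroup.mk l) e).coeff g ≠ 0 := by
    by_contra! hc
    exact h (MonoidAlgebra.coeff_injective (Finsupp.ext hc))
  obtain ⟨p, d, q, rfl, hd, -⟩ := exists_eq_position ρ l e g hg
  exact ⟨d, by simp, hd⟩

theorem exists_first_occurrence {l : List (E × Bool)} {e : E} (h : ∃ d ∈ l, d.1 = e) :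
    ∃ p d q, l = p ++ d :: q ∧ d.1 = e ∧ ∀ x ∈ p, x.1 ≠ e := by
  induction l with
  | nil => simp at h
  | cons d l ih =>
    by_cases hd : d.1 = e
    · exact ⟨[], d, l, rfl, hd, by simp⟩
    · obtain ⟨p, d', q, rfl, hd', hp⟩ := ih (by simpa [hd] using h)
      exact ⟨d :: p, d', q, rfl, hd', by simpa [hd] using hp⟩

/-- If the Fox derivative of a word at one of its letters vanishes, then the first occurrence of the
letter has the same position as another one. -/
theorem exists_position_eq_of_fox_eq_zero {l : List (E × Bool)} {e : E} (he : ∃ d ∈ l, d.1 = e)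
    (h : fox ρ (FreeGroup.mk l) e = 0) :
    ∃ p d m d' q, l = p ++ d :: m ++ d' :: q ∧ d.1 = e ∧ d'.1 = e ∧
      position ρ [] d = position ρ (d :: m) d' := by
  classical
  obtain ⟨p, d, q, rfl, hd, hp⟩ := exists_first_occurrence he
  have h0 : fox ρ (FreeGroup.mk p) e = 0 := by
    by_contra hc
    obtain ⟨x, hx, hxe⟩ := exists_mem_of_fox_ne_zero ρ hc
    exact hp x hx hxe
  rw [fox_mk_append, Pi.add_apply, h0, zero_add, Pi.smul_apply, smul_eq_mul] at h
  have h1 : fox ρ (FreeGroup.mk (d :: q)) e = 0 := by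
    have := congrArg (fun z => MonoidAlgebra.of ℤ _ (ρ (FreeGroup.mk p))⁻¹ * z) h
    simpa only [← mul_assoc, ← map_mul, inv_mul_cancel, map_one, one_mul, mul_zero] using this
  rw [← List.singleton_append, fox_mk_append, Pi.add_apply, fox_letter, if_pos hd, Pi.smul_apply,
    smul_eq_mul, MonoidAlgebra.of_apply] at h1
  have h2 := congrArg (fun z => z.coeff (position ρ [] d)) h1
  simp only [MonoidAlgebra.coeff_add, Finsupp.add_apply, MonoidAlgebra.coeff_single,
    Finsupp.single_eq_same, MonoidAlgebra.coeff_single_mul_apply, one_mul, MonoidAlgebra.coeff_zero,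
    Finsupp.zero_apply] at h2
  -- The ±1 contributed by `d` has to be cancelled by a later letter.
  have h3 : (fox ρ (FreeGroup.mk q) e).coeff ((ρ (FreeGroup.mk [d]))⁻¹ * position ρ [] d) ≠ 0 := by
    intro h3
    rw [h3] at h2
    rcases d with ⟨a, _ | _⟩ <;> simp at h2
  obtain ⟨m, d', t, rfl, hd', hpos⟩ := exists_eq_position ρ q e _ h3
  refine ⟨p, d, m, d', t, by simp, hd, hd', ?_⟩
  rw [← List.singleton_append, position_append, ← hpos, mul_inv_cancel_left]

/-- The Fox derivative of a reduced word is nonzero at each of its letters, if no proper subword is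
trivial in the image of `ρ`. -/
theorem fox_ne_zero {l : List (E × Bool)} (hl : l.IsChain fun a b => b ≠ (a.1, !a.2))
    (hsub : ∀ p a q, l = p ++ a ++ q → a ≠ [] → p ++ q ≠ [] → ρ (FreeGroup.mk a) ≠ 1)
    {e : E} (he : ∃ d ∈ l, d.1 = e) : fox ρ (FreeGroup.mk l) e ≠ 0 := by
  intro h
  obtain ⟨p, d, m, d', q, rfl, hd, hd', hpos⟩ := exists_position_eq_of_fox_eq_zero ρ he h
  have h6 : (FreeGroup.mk [] : FreeGroup E) = 1 := rfl
  have hback : m = [] → d' ≠ (d.1, !d.2) := by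
    rintro rfl
    have h1 : (d :: [] ++ d' :: q).IsChain fun a b => b ≠ (a.1, !a.2) := by
      rw [List.append_assoc] at hl
      exact hl.right_of_append
    simp at h1
    exact h1.1
  have hm : d' = (d.1, !d.2) → ρ (FreeGroup.mk m) ≠ 1 := fun hdd =>
    hsub (p ++ [d]) m (d' :: q) (by simp) (fun hm => hback hm hdd) (by simp)
  obtain ⟨a, b⟩ := d
  obtain ⟨a', b'⟩ := d'
  obtain rfl : a = e := hd
  obtain rfl : a' = a := hd'
  have hcons : ∀ x : E × Bool, ∀ t : List (E × Bool), ρ (FreeGroup.mk (x :: t)) =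
    ρ (FreeGroup.mk [x]) * ρ (FreeGroup.mk t) := fun x t => by
      rw [← map_mul, FreeGroup.mul_mk]; rfl
  -- Equal positions make a subword trivial: for equal signs, `m` with one of the two letters; for
  -- opposite signs, `m` itself, which is nonempty because the word is reduced.
  cases b <;> cases b' <;> simp only [position, cond_true, cond_false, List.nil_append, h6, map_one] at hpos
  · refine hsub (p ++ [(a', false)]) (m ++ [(a', false)]) q (by simp) (by simp) (by simp) ?_
    rw [List.cons_append, hcons _ (m ++ _), eq_comm] at hpos
    exact mul_eq_left.1 hpos
  · rw [hcons _ m, eq_comm] at hpos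
    exact hm rfl (mul_eq_left.1 hpos)
  · refine hm rfl ?_
    rw [List.cons_append, hcons, ← FreeGroup.mul_mk, map_mul] at hpos
    have h7 : (FreeGroup.mk [(a', false)] : FreeGroup E) = (FreeGroup.mk [(a', true)])⁻¹ := rfl
    rw [h7, map_inv, ← mul_assoc, eq_comm, conj_eq_one_iff] at hpos
    exact hpos
  · exact hsub p ((a', true) :: m) ((a', true) :: q) (by simp) (by simp) (by simp) hpos.symm

end FoxCalculus

/-! ### Subwords of the relators of a bislim presentation -/

namespace FoxCalculus

variable {E F : Type*}

theorem exists_finset_mem_normalClosure (r : F → FreeGroup E) {x : FreeGroup E}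
    (hx : x ∈ Subgroup.normalClosure (Set.range r)) :
    ∃ S : Finset F, x ∈ Subgroup.normalClosure (r '' (S : Set F)) := by
  classical
  induction hx using Subgroup.closure_induction with
  | mem y hy =>
    obtain ⟨_, ⟨s, rfl⟩, hy⟩ := Group.mem_conjugatesOfSet_iff.1 hy
    exact ⟨{s}, Subgroup.subset_closure
      (Group.mem_conjugatesOfSet_iff.2 ⟨r s, ⟨s, by simp, rfl⟩, hy⟩)⟩
  | one => exact ⟨∅, Subgroup.one_mem _⟩
  | mul x y _ _ hx hy =>
    obtain ⟨S, hS⟩ := hx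
    obtain ⟨T, hT⟩ := hy
    exact ⟨S ∪ T, Subgroup.mul_mem _
      (Subgroup.normalClosure_mono (Set.image_mono (by simp)) hS)
      (Subgroup.normalClosure_mono (Set.image_mono (by simp)) hT)⟩
  | inv x _ hx =>
    obtain ⟨S, hS⟩ := hx
    exact ⟨S, Subgroup.inv_mem _ hS⟩

/-! ### Cyclic subwords and letters occurring once -/

theorem isChain_of_append_isRotated {α : Type*} {R : α → α → Prop} {a b w : List α}
    (hw : (w ++ w).IsChain R) (h : a ++ b ~r w) : a.IsChain R := by
  obtain ⟨n, hn, h⟩ := List.isRotated_iff_mod.1 h.symm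
  rw [List.rotate_eq_drop_append_take hn] at h
  have h1 : a <:+: w ++ w := by
    refine List.IsInfix.trans (l₂ := a ++ b) ⟨[], b, rfl⟩ ⟨w.take n, w.drop n, ?_⟩
    rw [← h]
    simp only [List.append_assoc, List.take_append_drop]
    rw [← List.append_assoc, List.take_append_drop]
  exact hw.infix h1

theorem append_isRotated_of_eq_append {α : Type*} {p a q w : List α} (h : w = p ++ a ++ q) :
    a ++ (q ++ p) ~r w ∧ (q ++ p) ++ a ~r w := by
  subst h
  have h1 : a ++ (q ++ p) ~r p ++ a ++ q := by
    have := List.isRotated_append (l := a ++ q) (l' := p)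
    simpa using this
  exact ⟨h1, List.isRotated_append.trans h1⟩

theorem exists_split_of_countP_eq_one [DecidableEq E] {l : List (E × Bool)} {e : E}
    (h : l.countP (fun d => d.1 = e) = 1) :
    ∃ p d q, l = p ++ d :: q ∧ d.1 = e ∧ ∀ x ∈ p ++ q, x.1 ≠ e := by
  obtain ⟨p, d, q, rfl, hd, -⟩ := exists_first_occurrence (l := l) (e := e) (by
    obtain ⟨d, hd, he⟩ := List.countP_pos_iff.1 (by rw [h]; exact Nat.one_pos)
    exact ⟨d, hd, by simpa using he⟩)
  refine ⟨p, d, q, rfl, hd, ?_⟩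
  have h1 : (p ++ q).countP (fun d => d.1 = e) = 0 := by
    rw [List.countP_append, List.countP_cons_of_pos (by simpa using hd)] at h
    rw [List.countP_append]
    omega
  simpa using List.countP_eq_zero.1 h1

theorem fox_ne_zero_of_countP_eq_one [DecidableEq E] (ρ : FreeGroup E →* FreeGroup E)
    {l : List (E × Bool)} {e : E} (h : l.countP (fun d => d.1 = e) = 1) :
    fox ρ (FreeGroup.mk l) e ≠ 0 := by
  intro h0
  obtain ⟨d, hd, he⟩ := List.countP_pos_iff.1 (show 0 < l.countP (fun d => d.1 = e) by omega)
  obtain ⟨p, d, m, d', q, rfl, hd, hd', -⟩ :=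
    exists_position_eq_of_fox_eq_zero ρ ⟨d, hd, by simpa using he⟩ h0
  rw [List.countP_append, List.countP_append, List.countP_cons_of_pos (by simpa using hd),
    List.countP_cons_of_pos (by simpa using hd')] at h
  omega

/-- Since `w` is trivial, a subword is trivial exactly when its cyclic complement is, and one of the
two avoids the letter `e`. Passing to rotations thus reduces to subwords avoiding `e`. -/
theorem map_mk_ne_one_of_infix [DecidableEq E] (ρ : FreeGroup E →* FreeGroup E)
    {w : List (E × Bool)} {e : E} (hw : ρ (FreeGroup.mk w) = 1)
    (he : w.countP (fun d => d.1 = e) = 1)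
    (h : ∀ a b, a ++ b ~r w → a ≠ [] → b ≠ [] → (∀ x ∈ a, x.1 ≠ e) → ρ (FreeGroup.mk a) ≠ 1)
    (p a q : List (E × Bool)) (hpaq : w = p ++ a ++ q) (ha : a ≠ []) (hpq : p ++ q ≠ []) :
    ρ (FreeGroup.mk a) ≠ 1 := by
  intro h1
  obtain ⟨r1, r2⟩ := append_isRotated_of_eq_append hpaq
  have hqp : q ++ p ≠ [] := by simpa [and_comm] using hpq
  by_cases hea : ∀ x ∈ a, x.1 ≠ e
  · exact h a (q ++ p) r1 ha hqp hea h1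
  · refine h (q ++ p) a r2 hqp ha ?_ ?_
    · push Not at hea
      obtain ⟨d, hd, hde⟩ := hea
      have h2 : 0 < a.countP (fun d => d.1 = e) := List.countP_pos_iff.2 ⟨d, hd, by simpa using hde⟩
      have h3 : (q ++ p).countP (fun d => d.1 = e) = 0 := by
        rw [hpaq] at he
        simp only [List.countP_append] at he ⊢
        omega
      simpa using List.countP_eq_zero.1 h3
    · rw [hpaq, ← FreeGroup.mul_mk, ← FreeGroup.mul_mk, map_mul, map_mul, h1, mul_one] at hw
      rw [← FreeGroup.mul_mk, map_mul]
      exact mul_eq_one_comm.1 hw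

/-! ### The minimal counterexample -/

section Bislim

variable [Preorder E] [DecidableEq E] {w : F → List (E × Bool)} {plus minus : F → E}

theorem map_mk_ne_one_of_append_isRotated
    (hred : ∀ s, (w s ++ w s).IsChain fun a b => b ≠ (a.1, !a.2))
    (hplus : ∀ s, (w s).countP (fun d => d.1 = plus s) = 1)
    (hplus_lt : ∀ s t, s ≠ t → (∃ d ∈ w t, d.1 = plus s) → plus s < plus t)
    (hminus : ∀ s, ∃ d ∈ w s, d.1 = minus s)
    (hminus_lt : ∀ s t, s ≠ t → (∃ d ∈ w s, d.1 = minus t) → plus s < plus t)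
    (S : Finset F) (ρ : FreeGroup E →* FreeGroup E)
    (hρ : ∀ x, ρ x = 1 ↔
      x ∈ Subgroup.normalClosure ((fun s => FreeGroup.mk (w s)) '' (S : Set F)))
    {s : F} (hs : s ∈ S) (a b : List (E × Bool)) (hab : a ++ b ~r w s) (ha : a ≠ []) (hb : b ≠ [])
    (hsa : ∀ x ∈ a, x.1 ≠ plus s) : ρ (FreeGroup.mk a) ≠ 1 := by
  classical
  intro ha1
  have hρS : ∀ t ∈ S, ρ (FreeGroup.mk (w t)) = 1 := fun t ht =>
    (hρ _).2 (Subgroup.subset_normalClosure ⟨t, ht, rfl⟩)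
  -- among the relators with a trivial subword avoiding the letter `plus`, choose a lowest one
  let bad : F → List (E × Bool) → Prop := fun s a =>
    (∃ b, a ++ b ~r w s ∧ b ≠ []) ∧ a ≠ [] ∧ (∀ x ∈ a, x.1 ≠ plus s) ∧ ρ (FreeGroup.mk a) = 1
  obtain ⟨s, hsB, hsmin⟩ := (S.filter fun s => ∃ a, bad s a).exists_minimalFor plus
    ⟨s, Finset.mem_filter.2 ⟨hs, a, ⟨b, hab, hb⟩, ha, hsa, ha1⟩⟩
  obtain ⟨hs, hbad⟩ := Finset.mem_filter.1 hsB
  have hgood : ∀ v ∈ S, plus v < plus s → ∀ a, ¬ bad v a := fun v hv hlt a hva =>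
    hlt.not_ge (hsmin (Finset.mem_filter.2 ⟨hv, a, hva⟩) hlt.le)
  obtain ⟨a, ⟨⟨b, hab, hb⟩, ha, hsa, ha1⟩, hamin⟩ :
      ∃ a, bad s a ∧ ∀ a', bad s a' → a.length ≤ a'.length := by
    have hex : ∃ n a, bad s a ∧ a.length = n := ⟨_, hbad.choose, hbad.choose_spec, rfl⟩
    obtain ⟨a, h1, h2⟩ := Nat.find_spec hex
    exact ⟨a, h1, fun a' h' => h2 ▸ Nat.find_min' hex ⟨a', h', rfl⟩⟩
  have hmem : ∀ x ∈ a, x ∈ w s := fun x hx => hab.mem_iff.1 (List.mem_append_left _ hx)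
  -- A trivial proper subword of `a` would be a shorter bad subword of `w s`, so `fox_ne_zero`
  -- applies to `a`.
  have hafox : ∃ e, fox ρ (FreeGroup.mk a) e ≠ 0 := by
    obtain ⟨d, a', rfl⟩ := List.exists_cons_of_ne_nil ha
    refine ⟨d.1, fox_ne_zero ρ (isChain_of_append_isRotated (hred s) hab) ?_ ⟨d, by simp, rfl⟩⟩
    intro p m q hpmq hm hpq hm1
    have hlen := hamin m ⟨⟨q ++ b ++ p, ?_, by simp [hb]⟩, hm, fun x hx => hsa x (by
      rw [hpmq]; simp [hx]), hm1⟩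
    · have h1 := congrArg List.length hpmq
      have h2 := List.length_pos_of_ne_nil hpq
      simp only [List.length_append] at h1 h2
      omega
    · refine List.IsRotated.trans ?_ hab
      rw [hpmq]
      exact (append_isRotated_of_eq_append (p := p) (a := m) (q := q ++ b) (by simp)).1
  obtain ⟨-, hspan⟩ := fox_mem_span ρ (fun s => FreeGroup.mk (w s)) (S : Set F) hρS ((hρ _).1 ha1)
  obtain ⟨c, hc⟩ := (Submodule.mem_span_image_finset_iff_exists_fun' _).1 hspan
  have hfox : ∀ e, fox ρ (FreeGroup.mk a) e = ∑ t ∈ S, c t * fox ρ (FreeGroup.mk (w t)) e := by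
    intro e
    rw [← hc, Finset.sum_apply]
    rfl
  -- a relator involved in the filling of `a` whose letter `e` is not in the others puts `e` in `a`
  have hfree : ∀ v ∈ S, c v ≠ 0 → ∀ e, fox ρ (FreeGroup.mk (w v)) e ≠ 0 →
      (∀ t ∈ S, c t ≠ 0 → t ≠ v → ¬ ∃ d ∈ w t, d.1 = e) → ∃ d ∈ a, d.1 = e := by
    intro v hv hcv e hve hother
    refine exists_mem_of_fox_ne_zero ρ ?_
    rw [hfox, Finset.sum_eq_single v]
    · exact mul_ne_zero hcv hve
    · intro t ht htv
      by_cases hct : c t = 0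
      · rw [hct, zero_mul]
      · have : fox ρ (FreeGroup.mk (w t)) e = 0 := by
          by_contra h
          exact hother t ht hct htv (exists_mem_of_fox_ne_zero ρ h)
        rw [this, mul_zero]
    · exact fun h => absurd hv h
  have hT : (S.filter fun t => c t ≠ 0).Nonempty := by
    obtain ⟨e, he⟩ := hafox
    rw [hfox] at he
    obtain ⟨t, ht, hte⟩ := Finset.exists_ne_zero_of_sum_ne_zero he
    exact ⟨t, Finset.mem_filter.2 ⟨ht, left_ne_zero_of_mul hte⟩⟩
  obtain ⟨v, hvT, hvmin⟩ := Finset.exists_minimalFor plus _ hT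
  obtain ⟨hv, hcv⟩ := Finset.mem_filter.1 hvT
  -- The preorder need not be total, so `u` is sought only above `v`; this keeps `plus v` comparable
  -- with `plus s`.
  obtain ⟨u, huT, humax⟩ := ((S.filter fun t => c t ≠ 0).filter fun t => plus v ≤ plus t).exists_maximalFor
    plus ⟨v, Finset.mem_filter.2 ⟨hvT, le_rfl⟩⟩
  obtain ⟨huT, hvu⟩ := Finset.mem_filter.1 huT
  obtain ⟨hu, hcu⟩ := Finset.mem_filter.1 huT
  obtain ⟨d, hda, hdu⟩ := hfree u hu hcu (plus u) (fox_ne_zero_of_countP_eq_one ρ (hplus u))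
    fun t ht hct htu htd => by
      have hlt := hplus_lt u t (Ne.symm htu) htd
      exact hlt.not_ge (humax (Finset.mem_filter.2
        ⟨Finset.mem_filter.2 ⟨ht, hct⟩, hvu.trans hlt.le⟩) hlt.le)
  have hus : u ≠ s := by
    rintro rfl
    exact hsa d hda hdu
  have hvs : plus v < plus s := hvu.trans_lt (hplus_lt u s hus ⟨d, hmem d hda, hdu⟩)
  -- The letter `minus v` may occur repeatedly in `w v`; cancellation is excluded because `v` lies
  -- below the lowest bad relator.
  have hvfox : fox ρ (FreeGroup.mk (w v)) (minus v) ≠ 0 :=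
    fox_ne_zero ρ (hred v).left_of_append
      (map_mk_ne_one_of_infix ρ (hρS v hv) (hplus v) fun a b hab ha hb hva h1 =>
        hgood v hv hvs a ⟨⟨b, hab, hb⟩, ha, hva, h1⟩) (hminus v)
  obtain ⟨d, hda, hdv⟩ := hfree v hv hcv (minus v) hvfox fun t ht hct htv htd => by
    have hlt := hminus_lt t v htv htd
    exact hlt.not_ge (hvmin (Finset.mem_filter.2 ⟨ht, hct⟩) hlt.le)
  have hsv : s ≠ v := by
    rintro rfl
    exact lt_irrefl _ hvs
  exact lt_asymm hvs (hminus_lt s v hsv ⟨d, hmem d hda, hdv⟩)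

/-- No proper nonempty subword of a relator of a bislim presentation is trivial in the presented
group. -/
theorem mk_notMem_normalClosure_of_infix
    (hred : ∀ s, (w s ++ w s).IsChain fun a b => b ≠ (a.1, !a.2))
    (hplus : ∀ s, (w s).countP (fun d => d.1 = plus s) = 1)
    (hplus_lt : ∀ s t, s ≠ t → (∃ d ∈ w t, d.1 = plus s) → plus s < plus t)
    (hminus : ∀ s, ∃ d ∈ w s, d.1 = minus s)
    (hminus_lt : ∀ s t, s ≠ t → (∃ d ∈ w s, d.1 = minus t) → plus s < plus t)
    {s : F} {p a q : List (E × Bool)} (hw : w s = p ++ a ++ q) (ha : a ≠ []) (hpq : p ++ q ≠ []) :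
    FreeGroup.mk a ∉ Subgroup.normalClosure (Set.range fun s => FreeGroup.mk (w s)) := by
  classical
  intro h
  obtain ⟨S, hS⟩ := exists_finset_mem_normalClosure _ h
  -- Adding `s` to the finite set ensures that `ρ` kills `w s` as well.
  obtain ⟨ρ, hρ⟩ := exists_endomorphism_ker_eq_normalClosure w plus
    (fun s => exists_split_of_countP_eq_one (hplus s)) hplus_lt (insert s S)
  refine map_mk_ne_one_of_infix ρ ((hρ _).2 (Subgroup.subset_normalClosure ⟨s, by simp, rfl⟩))
    (hplus s) (map_mk_ne_one_of_append_isRotated hred hplus hplus_lt hminus hminus_lt _ ρ hρ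
      (Finset.mem_insert_self s S)) p a q hw ha hpq ((hρ _).2 ?_)
  exact Subgroup.normalClosure_mono (Set.image_mono (by simp)) hS

end Bislim

end FoxCalculus

namespace TwoComplex

variable {X : TwoComplex.{u, v, w}} {x₀ : X.V}

/-! ### Simple connectivity of the universal cover -/

theorem isPath_unique {x y z : X.V} {l : List (X.E × Bool)} (h : X.IsPath x l y)
    (h' : X.IsPath x l z) : y = z := by
  induction l generalizing x with
  | nil => exact h.symm.trans h'
  | cons d l ih => exact ih h.2 h'.2

theorem eq_base_of_isPath_bdry {x y : X.V} {f : X.F} (h : X.IsPath x (X.bdry f) y) :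
    x = X.base f ∧ y = X.base f := by
  have hx : x = X.base f := by
    have ne := X.bdry_ne_nil f
    have c := X.bdry_closed f
    revert ne c h
    cases X.bdry f with
    | nil => intro _ ne; exact absurd rfl ne
    | cons d l => intro h _ c; exact h.1.symm.trans c.1
  subst hx
  exact ⟨rfl, isPath_unique h (X.bdry_closed f)⟩

theorem PathClass.comp_mk_bdry {f : X.F} (c : X.PathClass x₀ (X.base f))
    (h : X.IsPath (X.base f) (X.bdry f) (X.base f)) : c.comp (PathClass.mk (X.bdry f) h) = c := by
  rcases c with ⟨p, hp⟩
  have k1 : X.IsPath x₀ (p ++ []) (X.base f) := by simpa using hp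
  have k2 : X.IsPath x₀ (p ++ X.bdry f ++ []) (X.base f) := by
    simpa using isPath_append hp (X.bdry_closed f)
  have := PathClass.mk_face p [] f k1 k2
  simp only [List.append_nil] at this
  exact this

theorem liftPath_append {y z t : X.V} (a b : List (X.E × Bool)) (c : X.PathClass x₀ y)
    (ha : X.IsPath y a z) (hb : X.IsPath z b t) (h : X.IsPath y (a ++ b) t) :
    liftPath (a ++ b) c h = liftPath a c ha ++ liftPath b (c.comp (PathClass.mk a ha)) hb := by
  induction a generalizing y with
  | nil =>
    cases ha
    have : c.comp (PathClass.mk [] rfl) = c := PathClass.comp_refl c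
    rw [this]
    rfl
  | cons d a ih =>
    have h1 : (c.snoc d h.1).comp (PathClass.mk a ha.2) = c.comp (PathClass.mk (d :: a) ha) :=
      PathClass.comp_assoc _ _ _
    rw [← h1]
    exact congrArg _ (ih (c.snoc d h.1) ha.2 h.2)

theorem liftEdge_rev {y : X.V} (c : X.PathClass x₀ y) (d : X.E × Bool) (h : X.org d = y)
    (h' : X.org (X.rev d) = X.ter d) :
    liftEdge (c.snoc d h) (X.rev d) h' = ((liftEdge c d h).1, !(liftEdge c d h).2) := by
  subst h
  rcases d with ⟨e, _ | _⟩
  · rfl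
  · have : (c.snoc (e, true) rfl).snoc (e, false) rfl = c :=
      (PathClass.comp_assoc _ _ _).trans (PathClass.snoc_snoc_rev c (e, true) rfl (X.src e) rfl rfl)
    exact Prod.ext (Sigma.ext rfl (heq_of_eq this)) rfl

theorem map_liftPath {y z : X.V} (l : List (X.E × Bool)) (c : X.PathClass x₀ y)
    (h : X.IsPath y l z) : (liftPath l c h).map (fun d => (d.1.1, d.2)) = l := by
  induction l generalizing y with
  | nil => rfl
  | cons d l ih =>
    have h1 : ((liftEdge c d h.1).1.1, (liftEdge c d h.1).2) = d := by
      rcases d with ⟨e, _ | _⟩ <;> rfl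
    change ((liftEdge c d h.1).1.1, (liftEdge c d h.1).2) :: _ = _
    rw [h1]
    exact congrArg _ (ih _ h.2)

variable (X x₀) in
/-- The normal closure of the boundary words of the 2-cells of the universal cover. -/
def boundaryNormalClosure : Subgroup (FreeGroup (X.CoverE x₀)) :=
  Subgroup.normalClosure (Set.range fun r : X.CoverF x₀ => FreeGroup.mk ((X.univCover x₀).bdry r))

instance : (boundaryNormalClosure X x₀).Normal := Subgroup.normalClosure_normal

/-- The class, modulo boundary words, of a word in the 1-cells of the universal cover. -/
def wordClass (l : List (X.CoverE x₀ × Bool)) :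
    FreeGroup (X.CoverE x₀) ⧸ boundaryNormalClosure X x₀ :=
  QuotientGroup.mk (FreeGroup.mk l)

theorem wordClass_append (l m : List (X.CoverE x₀ × Bool)) :
    wordClass (l ++ m) = wordClass l * wordClass m := by
  rw [wordClass, ← FreeGroup.mul_mk]; rfl

theorem wordClass_bdry (r : X.CoverF x₀) : wordClass ((X.univCover x₀).bdry r) = 1 :=
  (QuotientGroup.eq_one_iff _).2 (Subgroup.subset_normalClosure ⟨r, rfl⟩)

theorem wordClass_backtrack (d : X.CoverE x₀ × Bool) : wordClass [d, (d.1, !d.2)] = 1 := by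
  have : (FreeGroup.mk [d, (d.1, !d.2)] : FreeGroup (X.CoverE x₀)) = 1 :=
    Quot.sound (FreeGroup.Red.Step.not (L₁ := []) (L₂ := []) (x := d.1) (b := d.2))
  rw [wordClass, this]; rfl

/-- An inserted backtrack lifts to a backtrack and an inserted boundary path to that of a 2-cell of
the cover. Both lifts are closed and trivial modulo boundary words, so the rest of the lift is
unaffected. -/
theorem wordClass_liftPath_step {y : X.V} {p q : X.EdgePath x₀ y} (h : X.Step p q) :
    wordClass (liftPath p.1 (PathClass.refl x₀) p.2) =
      wordClass (liftPath q.1 (PathClass.refl x₀) q.2) := by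
  obtain ⟨p, hp⟩ := p
  obtain ⟨q, hq⟩ := q
  obtain ⟨a, m, b, h, h', hm⟩ := h
  dsimp only at h h' ⊢
  subst h h'
  obtain ⟨t, ham, hb⟩ := isPath_append_iff.1 hq
  obtain ⟨s, ha, hm'⟩ := isPath_append_iff.1 ham
  set c := (PathClass.refl x₀).comp (PathClass.mk a ha)
  obtain ⟨rfl, hc, hw⟩ : ∃ e : t = s, c.comp (PathClass.mk m (e ▸ hm')) = c ∧
      wordClass (liftPath m c hm') = 1 := by
    rcases hm with ⟨d, rfl⟩ | ⟨f, rfl⟩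
    · obtain ⟨h1, h2, h3⟩ := hm'
      have h4 : t = s := by rw [← show X.ter (X.rev d) = t from h3, ter_rev, h1]
      subst h4
      refine ⟨rfl, PathClass.snoc_snoc_rev c d h1 t h3 rfl, ?_⟩
      change wordClass [liftEdge c d h1, liftEdge (c.snoc d h1) (X.rev d) h2] = 1
      rw [liftEdge_rev]
      exact wordClass_backtrack _
    · obtain ⟨rfl, rfl⟩ := eq_base_of_isPath_bdry hm'
      exact ⟨rfl, PathClass.comp_mk_bdry c _, wordClass_bdry ⟨f, c⟩⟩
  rw [liftPath_append a b _ ha hb hp, liftPath_append (a ++ m) b _ ham hb hq,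
    liftPath_append a m _ ha hm' ham, wordClass_append, wordClass_append, wordClass_append]
  have h5 : (PathClass.refl x₀).comp (PathClass.mk (a ++ m) ham) = c :=
    (PathClass.comp_assoc (PathClass.refl x₀) (PathClass.mk a ha) (PathClass.mk m hm')).symm.trans hc
  rw [h5, hw, mul_one]

/-- The class of the lift of an edge path depends only on the homotopy class of the path. -/
def liftClass {y : X.V} (c : X.PathClass x₀ y) :
    FreeGroup (X.CoverE x₀) ⧸ boundaryNormalClosure X x₀ :=
  Quot.lift (fun p : X.EdgePath x₀ y => wordClass (liftPath p.1 (PathClass.refl x₀) p.2))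
    (fun _ _ h => wordClass_liftPath_step h) c

theorem liftClass_snoc {y : X.V} (c : X.PathClass x₀ y) (d : X.E × Bool) (h : X.org d = y) :
    liftClass (c.snoc d h) = liftClass c * wordClass [liftEdge c d h] := by
  rcases c with ⟨l, hl⟩
  change wordClass (liftPath (l ++ [d]) (PathClass.refl x₀) _) = _
  rw [liftPath_append l [d] _ hl ⟨h, rfl⟩, wordClass_append]
  rfl

/-- A 0-cell of the cover is itself a path class, so `liftClass` is a potential on 0-cells; along a
path the differences telescope. -/
theorem wordClass_edge (d : X.CoverE x₀ × Bool) :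
    wordClass [d] = (liftClass ((X.preCover x₀).org d).2)⁻¹ * liftClass ((X.preCover x₀).ter d).2 := by
  rcases d with ⟨⟨e, c⟩, b⟩
  have h : liftClass (c.snoc (e, true) rfl) = liftClass c * wordClass [(⟨e, c⟩, true)] :=
    liftClass_snoc c (e, true) rfl
  cases b
  · change _ = (liftClass (c.snoc (e, true) rfl))⁻¹ * liftClass c
    rw [h, mul_inv_rev, inv_mul_cancel_right]
    rfl
  · change _ = (liftClass c)⁻¹ * liftClass (c.snoc (e, true) rfl)
    rw [h, inv_mul_cancel_left]

theorem wordClass_of_isPath {a b : X.CoverV x₀} {l : List (X.CoverE x₀ × Bool)}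
    (h : (X.preCover x₀).IsPath a l b) : wordClass l = (liftClass a.2)⁻¹ * liftClass b.2 := by
  induction l generalizing a with
  | nil =>
    cases h
    rw [inv_mul_cancel]
    rfl
  | cons d l ih =>
    obtain ⟨rfl, h⟩ := h
    rw [← List.singleton_append, wordClass_append, ih h, wordClass_edge]
    group

/-- Closed edge paths of the universal cover are products of conjugates of boundary paths. -/
theorem mk_mem_boundaryNormalClosure {a : X.CoverV x₀} {l : List (X.CoverE x₀ × Bool)}
    (h : (X.univCover x₀).IsPath a l a) : FreeGroup.mk l ∈ boundaryNormalClosure X x₀ := by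
  have h1 := wordClass_of_isPath h
  rw [inv_mul_cancel] at h1
  exact (QuotientGroup.eq_one_iff _).1 h1

/-! ### Embedding of 2-cells -/

theorem Immersed.univCover (hX : X.Immersed) : (X.univCover x₀).Immersed := by
  rintro ⟨f, c⟩
  have h1 := hX f
  rw [← map_liftPath (X.bdry f) c (X.bdry_closed f), ← List.map_append, List.isChain_map] at h1
  refine h1.imp fun a b h hab => h ?_
  rw [hab]
  rfl

theorem TraversedOnce.countP_eq_one [DecidableEq X.E] {e : X.E} {f : X.F}
    (h : X.TraversedOnce e f) : (X.bdry f).countP (fun d => d.1 = e) = 1 := by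
  obtain ⟨i, hi, huniq⟩ := h
  dsimp only at hi huniq
  revert i
  generalize X.bdry f = l
  intro i hi huniq
  obtain ⟨p, d, q, rfl, hd, hp⟩ := FoxCalculus.exists_first_occurrence (l := l) (e := e)
    ⟨l.get i, List.get_mem _ _, hi⟩
  have hq : ∀ x ∈ q, x.1 ≠ e := by
    intro x hx hxe
    obtain ⟨m, t, rfl⟩ := List.mem_iff_append.1 hx
    have h1 := huniq ⟨p.length, by simp⟩ (by simpa using hd)
    have h2 := huniq ⟨p.length + (m.length + 1), by simp⟩ (by simpa using hxe)
    have h3 := congrArg Fin.val (h1.trans h2.symm)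
    simp at h3
  rw [List.countP_append, List.countP_cons_of_pos (by simpa using hd),
    List.countP_eq_zero.2 (by simpa using hp), List.countP_eq_zero.2 (by simpa using hq)]

theorem pairwise_of_forall_split {α : Type*} {R : α → α → Prop} {l : List α}
    (h : ∀ p a m b q, l = p ++ a :: m ++ b :: q → R a b) : l.Pairwise R := by
  induction l with
  | nil => exact List.Pairwise.nil
  | cons x l ih =>
    refine List.pairwise_cons.2 ⟨fun b hb => ?_, ih fun p a m b q hl => h (x :: p) a m b q (by simp [hl])⟩
    obtain ⟨m, q, rfl⟩ := List.mem_iff_append.1 hb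
    exact h [] x m b q rfl

/-- A 2-cell of an immersed complex embeds if no proper nonempty subpath of its boundary path is
closed. -/
theorem FaceEmbeds.of_forall_not_isPath (hX : X.Immersed) {f : X.F}
    (h : ∀ p a q x, X.bdry f = p ++ a ++ q → a ≠ [] → p ++ q ≠ [] → ¬ X.IsPath x a x) :
    X.FaceEmbeds f := by
  have horg : ∀ p a m b q, X.bdry f = p ++ a :: m ++ b :: q → X.org a ≠ X.org b := by
    intro p a m b q hf hab
    have h1 := X.bdry_closed f
    rw [hf] at h1
    obtain ⟨y, h2, h3⟩ := isPath_append_iff.1 h1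
    obtain ⟨z, -, h4⟩ := isPath_append_iff.1 h2
    have hyz : y = z := h3.1.symm.trans (hab.symm.trans h4.1)
    subst hyz
    exact h p (a :: m) (b :: q) y hf (by simp) (by simp) h4
  refine ⟨List.pairwise_map.2 (pairwise_of_forall_split horg),
    List.pairwise_map.2 (pairwise_of_forall_split fun p a m b q hf hab => ?_)⟩
  by_cases hb : b.2 = a.2
  · exact horg p a m b q hf (by rw [Prod.ext hab hb.symm])
  · have hrev : b = X.rev a := Prod.ext hab.symm (by
      change b.2 = !a.2
      revert hb
      cases a.2 <;> cases b.2 <;> decide)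
    have h1 := X.bdry_closed f
    rw [hf] at h1
    obtain ⟨y, h2, h3⟩ := isPath_append_iff.1 h1
    obtain ⟨z, -, h4⟩ := isPath_append_iff.1 h2
    have hy : X.ter a = y := by rw [← h3.1, hrev, org_rev]
    -- For opposite traversals, the stretch `m` strictly between them is closed; were it empty, `a`
    -- and `b` would form a backtrack.
    refine h (p ++ [a]) m (b :: q) y (by simp [hf]) ?_ (by simp) (hy ▸ h4.2)
    rintro rfl
    have h5 := (hX f).left_of_append
    rw [hf, List.append_assoc] at h5
    have h6 := h5.right_of_append
    simp at h6
    exact h6.1 hrev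

end TwoComplex

open TwoComplex in
theorem mainTheorem9 (X : TwoComplex.{u, v, w}) (x₀ : X.V) (hX : X.IsBislim x₀)
    (r : (X.univCover x₀).F) : (X.univCover x₀).FaceEmbeds r := by
  classical
  obtain ⟨himm, ⟨B⟩⟩ := hX
  have himm' := himm.univCover (x₀ := x₀)
  let _ : Preorder (X.univCover x₀).E :=
    { le := B.le
      le_refl := B.le_refl
      le_trans := B.le_trans }
  refine FaceEmbeds.of_forall_not_isPath himm' fun p a q x hr ha hpq hx => ?_
  exact FoxCalculus.mk_notMem_normalClosure_of_infix (w := (X.univCover x₀).bdry) himm'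
    (fun s => (B.plus_once s).countP_eq_one) B.plus_lt B.minus_mem
    (fun s t => B.minus_lt s t) hr ha hpq (mk_mem_boundaryNormalClosure hx)
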